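/- Let ${\cal F}_n$ be the set of Boolean functions $\{0,1\}^n\to\{0,1\}$. A legitimate model of order $n$ of Boolean circuits over $\{\neg,\wedge_2,\vee_2\}$ consists of a set $\{0,1,x_1,\dots,x_n\}\subseteq{\cal M}\subseteq{\cal F}_n$ together with an operation $\overline{\neg}:{\cal M}\to{\cal M}$ and commutative operations $\overline{\wedge},\overline{\vee}:{\cal M}\times{\cal M}\to{\cal M}$ (the approximators). For a connective $\circ\in\{\neg,\wedge_2,\vee_2\}$ of arity $a$ and $f_1,\dots,f_a\in{\cal M}$, the error set is $\delta_\circ(f_1,\dots,f_a):=\{x\in\{0,1\}^n : \circ(f_1,\dots,f_a)(x)\neq\overline{\circ}(f_1,\dots,f_a)(x)\}$. The distance $\rho(f,{\cal M})$ of $f\in{\cal F}_n$ from ${\cal M}$ is the minimal $t$ such that for some $g\in{\cal M}$ the set $\{x : f(x)\neq g(x)\}$ is covered by $t$ error sets ($\infty$ if there is no such $t$). For a circuit $C$ over $\{\neg,\wedge_2,\vee_2\}$ with $p$ inputs and $f_1,\dots,f_p\in{\cal M}$, let $\overline{C}(f_1,\dots,f_p)\in{\cal M}$ be the function obtained by putting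 $f_i$ at the $i$th input of $C$, keeping the constants $0,1$, and replacing each gate $\circ$ by $\overline{\circ}$. The model is 0-projective if, whenever $J\subseteq\{1,\dots,n\}$ and $C$ is a circuit over $\{\neg,\wedge_2,\vee_2\}$ with inputs $x_j$, $j\in J$, the function $\overline{C}((x_j)_{j\in J})$ depends only on the coordinates in $J$. It is projective if for all $p$, each circuit $C$ over $\{\neg,\wedge_2,\vee_2\}$ with $p$ inputs, all $f_1,\dots,f_p\in{\cal M}$ and all $z,y\in\{0,1\}^n$ with $f_i(z)=f_i(y)$ for $i=1,\dots,p$, we have $\overline{C}(f_1,\dots,f_p)(z)=\overline{C}(f_1,\dots,f_p)(y)$. The size of a circuit is the number of its gates (all vertices other than inputs). Theorem. There is an absolute constant $K$ such that the following holds for all $n,k,m,s\in\mathbb{N}$, each legitimate model ${\cal M}$ of order $n$ of Boolean circuits over $\{\neg,\wedge_2,\vee_2\}$ with $\overline{\neg}=\neg$, and each $f\in{\cal F}_n$ with $\rho(f,{\cal M})\ge s$. 1. $f$ is not computable by any circuit of size less than $s-K\,k\,n\,m$ whose gates are constants, $\neg,\wedge_2,\vee_2$ and at most $k$ oracle gates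 of arity $m$, computing arbitrary, possibly different and noncommutative, Boolean functions of $m$ inputs. 2. If ${\cal M}$ is 0-projective, then $f$ is not computable by any circuit of size less than $s-K\,k\,m^2$ whose gates are constants, $\neg,\wedge_2,\vee_2$ and at most $k$ oracle gates of arity $m$ as in item 1, where all inputs of the oracle gates are among $x_1,\neg x_1,\dots,x_n,\neg x_n$. 3. If ${\cal M}$ is projective, then $f$ is not computable by any circuit of size less than $s-K\,k\,m^2$ whose gates are constants, $\neg,\wedge_2,\vee_2$ and at most $k$ oracle gates of arity $m$ as in item 1, with no restriction on where the oracle gates are placed. -/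

import Mathlib

namespace ApproxMethod

/-- Boolean functions on `n` inputs. -/
abbrev BoolFn (n : ℕ) : Type := (Fin n → Bool) → Bool

/-! ### Circuits

Circuits are directed acyclic graphs, presented by listing their gates in a topological order.
The inputs of a gate form an ordered tuple, so that oracle gates may be noncommutative. -/

/-- A vertex of a circuit with inputs indexed by `ι` and with `s` gates. -/
inductive Node (ι : Type) (s : ℕ) : Type
  | input (i : ι) : Node ι s
  | gate (j : Fin s) : Node ι s

/-- A gate whose predecessors are inputs or one of the `s` gates listed before it. The oracle
gates are labelled by elements of `A` and have arity `m`. -/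
inductive Gate (ι A : Type) (m s : ℕ) : Type
  | const (b : Bool) : Gate ι A m s
  | neg (a : Node ι s) : Gate ι A m s
  | and (a b : Node ι s) : Gate ι A m s
  | or (a b : Node ι s) : Gate ι A m s
  | oracle (φ : A) (a : Fin m → Node ι s) : Gate ι A m s

/-- A topologically ordered list of `s` gates. -/
inductive Gates (ι A : Type) (m : ℕ) : ℕ → Type
  | nil : Gates ι A m 0
  | snoc {s : ℕ} (G : Gates ι A m s) (g : Gate ι A m s) : Gates ι A m (s + 1)

/-- A circuit with inputs indexed by `ι`. Its size is the number of its gates, i.e. of its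
vertices that are not inputs (constants and oracle gates are counted). -/
structure Circuit (ι A : Type) (m : ℕ) : Type where
  size : ℕ
  gates : Gates ι A m size
  output : Node ι size

/-- Circuits over `¬, ∧₂, ∨₂` (no oracle gates). -/
abbrev PlainCircuit (ι : Type) : Type := Circuit ι Empty 0

/-- Circuits over `¬, ∧₂, ∨₂` and oracle gates of arity `m`; every oracle gate carries an arbitrary
function of its own. -/
abbrev OracleCircuit (n m : ℕ) : Type := Circuit (Fin n) (BoolFn m) m

/-- An interpretation of the labels of gates by operations on a type `α`. -/
structure Interp (α A : Type) (m : ℕ) : Type where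
  const : Bool → α
  neg : α → α
  and : α → α → α
  or : α → α → α
  oracle : A → (Fin m → α) → α

section eval

variable {α ι A : Type} {m : ℕ}

/-- The value at a vertex, given the values of the inputs and of the gates. -/
def Node.eval {s : ℕ} (inp : ι → α) (val : Fin s → α) : Node ι s → α
  | .input i => inp i
  | .gate j => val j

/-- The value of a gate, given the values of the inputs and of the preceding gates. -/
def Gate.eval {s : ℕ} (I : Interp α A m) (inp : ι → α) (val : Fin s → α) : Gate ι A m s → α
  | .const b => I.const b
  | .neg a => I.neg (a.eval inp val)
  | .and a b => I.and (a.eval inp val) (b.eval inp val)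
  | .or a b => I.or (a.eval inp val) (b.eval inp val)
  | .oracle φ a => I.oracle φ (fun i => (a i).eval inp val)

/-- The values of all gates. -/
def Gates.eval (I : Interp α A m) (inp : ι → α) : {s : ℕ} → Gates ι A m s → Fin s → α
  | _, .nil => Fin.elim0
  | _, .snoc G g =>
      Fin.snoc (α := fun _ => α) (G.eval I inp) (g.eval I inp (G.eval I inp))

/-- The value at the output. -/
def Circuit.eval (I : Interp α A m) (C : Circuit ι A m) (inp : ι → α) : α :=
  C.output.eval inp (C.gates.eval I inp)

/-- The number of oracle gates in a list of gates. -/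
def Gates.numOracles : {s : ℕ} → Gates ι A m s → ℕ
  | _, .nil => 0
  | _, .snoc G (.oracle _ _) => G.numOracles + 1
  | _, .snoc G (.const _) => G.numOracles
  | _, .snoc G (.neg _) => G.numOracles
  | _, .snoc G (.and _ _) => G.numOracles
  | _, .snoc G (.or _ _) => G.numOracles

/-- The number of oracle gates of a circuit. -/
def Circuit.numOracles (C : Circuit ι A m) : ℕ := C.gates.numOracles

/-- The gate number `j` is the negation of an input. -/
def Gates.IsNegInput : {s : ℕ} → Gates ι A m s → Fin s → Prop
  | _, .nil => fun j => j.elim0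
  | _, .snoc G g =>
      Fin.snoc (α := fun _ => Prop) G.IsNegInput (∃ i : ι, g = Gate.neg (Node.input i))

/-- The vertex is an input `xᵢ` or a negated input `¬xᵢ`. -/
def Gates.IsLiteral {s : ℕ} (G : Gates ι A m s) : Node ι s → Prop
  | .input _ => True
  | .gate j => G.IsNegInput j

/-- All inputs of all oracle gates are literals. -/
def Gates.OraclesReadLiterals : {s : ℕ} → Gates ι A m s → Prop
  | _, .nil => True
  | _, .snoc G g => G.OraclesReadLiterals ∧
      ∀ (φ : A) (a : Fin m → Node ι _), g = Gate.oracle φ a → ∀ i, G.IsLiteral (a i)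

/-- All inputs of all oracle gates of the circuit are among `x₁, ¬x₁, …, xₙ, ¬xₙ`. -/
def Circuit.OraclesReadLiterals (C : Circuit ι A m) : Prop := C.gates.OraclesReadLiterals

end eval

/-- The Boolean meaning of the gates. -/
def boolInterp (m : ℕ) : Interp Bool (BoolFn m) m where
  const b := b
  neg a := !a
  and a b := a && b
  or a b := a || b
  oracle φ v := φ v

/-- The oracle circuit `C` computes `f`. -/
def Circuit.Computes {n m : ℕ} (C : OracleCircuit n m) (f : BoolFn n) : Prop :=
  ∀ x : Fin n → Bool, C.eval (boolInterp m) x = f x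

/-! ### Approximation models -/

/-- A legitimate model of order `n` of circuits over `¬, ∧₂, ∨₂`. -/
structure LegitimateModel (n : ℕ) : Type where
  carrier : Set (BoolFn n)
  const_mem : ∀ b : Bool, (fun _ => b) ∈ carrier
  var_mem : ∀ i : Fin n, (fun x => x i) ∈ carrier
  neg : carrier → carrier
  and : carrier → carrier → carrier
  or : carrier → carrier → carrier
  and_comm : ∀ f g : carrier, and f g = and g f
  or_comm : ∀ f g : carrier, or f g = or g f

namespace LegitimateModel

variable {n : ℕ} (M : LegitimateModel n)

/-- The approximator of `¬` is `¬` itself. -/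
def NegExact : Prop := ∀ (f : M.carrier) (x : Fin n → Bool), (M.neg f).1 x = !(f.1 x)

/-- The input function `xᵢ` as an element of the model. -/
def var (i : Fin n) : M.carrier := ⟨fun x => x i, M.var_mem i⟩

/-- Gates are replaced by their approximators. -/
def interp : Interp M.carrier Empty 0 where
  const b := ⟨fun _ => b, M.const_mem b⟩
  neg := M.neg
  and := M.and
  or := M.or
  oracle e := e.elim

/-- The approximating circuit of `C` with the functions `fᵢ` of the model put at its inputs
(and approximated by themselves); with `fᵢ = xᵢ` this is the approximating circuit of `C`. -/
def approx {ι : Type} (C : PlainCircuit ι) (f : ι → M.carrier) : BoolFn n :=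
  (C.eval M.interp f).1

/-- `δ_¬(f)`. -/
def errNeg (f : M.carrier) : Set (Fin n → Bool) := {x | (!(f.1 x)) ≠ (M.neg f).1 x}

/-- `δ_∧(f, g)`. -/
def errAnd (f g : M.carrier) : Set (Fin n → Bool) := {x | (f.1 x && g.1 x) ≠ (M.and f g).1 x}

/-- `δ_∨(f, g)`. -/
def errOr (f g : M.carrier) : Set (Fin n → Bool) := {x | (f.1 x || g.1 x) ≠ (M.or f g).1 x}

/-- The collection `Δ` of all error sets. -/
def errorSets : Set (Set (Fin n → Bool)) :=
  {E | (∃ f, E = M.errNeg f) ∨ (∃ f g, E = M.errAnd f g) ∨ (∃ f g, E = M.errOr f g)}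

/-- For some `g` in the model, `f ⊕ g` is covered by `t` error sets. -/
def Covered (f : BoolFn n) (t : ℕ) : Prop :=
  ∃ g ∈ M.carrier, ∃ E : Fin t → Set (Fin n → Bool),
    (∀ i, E i ∈ M.errorSets) ∧ {x | f x ≠ g x} ⊆ ⋃ i, E i

/-- The distance `ρ(f, M)`: the minimal `t` with `M.Covered f t`, and `⊤` if there is none. -/
noncomputable def dist (f : BoolFn n) : ℕ∞ := ⨅ (t : ℕ) (_ : M.Covered f t), (t : ℕ∞)

/-- 0-projectivity: if the inputs of `C` are among `xⱼ`, `j ∈ J`, then the approximating circuit of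
`C` depends only on the coordinates in `J`. -/
def ZeroProjective : Prop :=
  ∀ (J : Set (Fin n)) (C : PlainCircuit J) (z y : Fin n → Bool), (∀ j ∈ J, z j = y j) →
    M.approx C (fun j => M.var j.1) z = M.approx C (fun j => M.var j.1) y

/-- Projectivity: the approximating circuit of `C` with functions `f₁, …, f_p` of the model at its
inputs depends only on the values of `f₁, …, f_p`. -/
def Projective : Prop :=
  ∀ (p : ℕ) (C : PlainCircuit (Fin p)) (f : Fin p → M.carrier) (z y : Fin n → Bool),
    (∀ i, (f i).1 z = (f i).1 y) → M.approx C f z = M.approx C f y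

end LegitimateModel

end ApproxMethod

/-!
An oracle gate computing `φ (g₁, …, g_m)` is replaced by an element of the model that agrees with
it outside `O (N m)` error sets, where `2 ^ N` bounds the number of classes of points that the
functions generated by the `gᵢ` can distinguish (`LegitimateModel.exists_approx`). Ordinary gates
cost one error set each, so a circuit for `f` with few oracle gates would make the distance of `f`
from the model too small (`LegitimateModel.not_computes`). In an arbitrary model `N = n`. In a
projective model the generated functions depend only on the values of the `gᵢ`, and in a
0-projective model with literals `gᵢ` only on the `m` variables involved, so `N = m`.

The approximation of `φ` rests on a random self-reduction. Branching on `g₁, …, g_m` gives an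
element `H a` of the model for every Boolean function `a` of `m` variables
(`LegitimateModel.exists_family`). At a point `x`, the element `H a` can be wrong only if `x` lies
in an error set of one of the `m` branchings on the path of `x`, and when `a` is uniformly random,
the restriction of `a` reached at a given depth is uniformly random whatever the path. Hence, if
`H a` is wrong at `x` with constant probability, then a random error set from a pool that does not
depend on `x` contains `x` with probability of order `1 / m`; greedily, `O (N m)` error sets cover
all such points (`exists_cover`). At every other point, `H a` and `H (a + φ)` are both right for
most `a`, and so is their sum as a value of `φ`. The majority of `O (N)` such sums is right at
all these points simultaneously (`exists_sample`). It costs `O (N)` further error sets, because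
the majority of `T` bits has circuits of size `O (T)` (`LegitimateModel.exists_majority`).
-/

namespace ApproxMethod
namespace LegitimateModel

/-! ### Arithmetic in a model -/

variable {n : ℕ} (M : LegitimateModel n) {ι : Type} (b : ι → M.carrier)

/-- The elements of the model obtained from the family `b` and the constants by the approximate
operations, i.e. the values at `b` of the approximating circuits. -/
inductive Generated : M.carrier → Prop
  | const (c : Bool) : Generated ⟨fun _ => c, M.const_mem c⟩
  | base (i : ι) : Generated (b i)
  | neg {u : M.carrier} : Generated u → Generated (M.neg u)
  | and {u v : M.carrier} : Generated u → Generated v → Generated (M.and u v)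
  | or {u v : M.carrier} : Generated u → Generated v → Generated (M.or u v)

/-- The error sets of `∧` and `∨` at elements generated by `b`. Those of `¬` are left out: they are
empty when `¬` is exact. -/
def generatedErrors : Set (Set (Fin n → Bool)) :=
  {E | ∃ u v, M.Generated b u ∧ M.Generated b v ∧ (E = M.errAnd u v ∨ E = M.errOr u v)}

/-- The element `h`, generated by `b`, agrees with `F` outside the error sets listed in `L`. -/
structure Realizes (L : List (Set (Fin n → Bool))) (h : M.carrier) (F : BoolFn n) : Prop where
  generated : M.Generated b h
  errors : ∀ E ∈ L, E ∈ M.generatedErrors b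
  agree : ∀ x, (∀ E ∈ L, x ∉ E) → h.1 x = F x

variable {M b}

theorem generatedErrors_subset : M.generatedErrors b ⊆ M.errorSets := by
  rintro E ⟨u, v, -, -, h | h⟩
  · exact Or.inr (Or.inl ⟨u, v, h⟩)
  · exact Or.inr (Or.inr ⟨u, v, h⟩)

theorem Generated.realizes {u : M.carrier} (hu : M.Generated b u) : M.Realizes b [] u u.1 :=
  ⟨hu, by simp, fun _ _ => rfl⟩

namespace Realizes

variable {L L₁ L₂ : List (Set (Fin n → Bool))} {h h₁ h₂ : M.carrier} {F F₁ F₂ : BoolFn n}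

theorem neg (hM : M.NegExact) (H : M.Realizes b L h F) :
    M.Realizes b L (M.neg h) (fun x => !F x) :=
  ⟨.neg H.generated, H.errors, fun x hx => by rw [hM, H.agree x hx]⟩

theorem and (H₁ : M.Realizes b L₁ h₁ F₁) (H₂ : M.Realizes b L₂ h₂ F₂) :
    M.Realizes b (M.errAnd h₁ h₂ :: (L₁ ++ L₂)) (M.and h₁ h₂) (fun x => F₁ x && F₂ x) where
  generated := .and H₁.generated H₂.generated
  errors E hE := by
    rcases List.mem_cons.1 hE with rfl | hE
    · exact ⟨h₁, h₂, H₁.generated, H₂.generated, Or.inl rfl⟩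
    · exact (List.mem_append.1 hE).elim (H₁.errors E) (H₂.errors E)
  agree x hx := by
    have h0 := hx _ (List.mem_cons_self ..)
    rw [← H₁.agree x fun E hE => hx E (by simp [hE]), ← H₂.agree x fun E hE => hx E (by simp [hE])]
    simpa [errAnd, eq_comm] using h0

theorem or (H₁ : M.Realizes b L₁ h₁ F₁) (H₂ : M.Realizes b L₂ h₂ F₂) :
    M.Realizes b (M.errOr h₁ h₂ :: (L₁ ++ L₂)) (M.or h₁ h₂) (fun x => F₁ x || F₂ x) where
  generated := .or H₁.generated H₂.generated
  errors E hE := by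
    rcases List.mem_cons.1 hE with rfl | hE
    · exact ⟨h₁, h₂, H₁.generated, H₂.generated, Or.inr rfl⟩
    · exact (List.mem_append.1 hE).elim (H₁.errors E) (H₂.errors E)
  agree x hx := by
    have h0 := hx _ (List.mem_cons_self ..)
    rw [← H₁.agree x fun E hE => hx E (by simp [hE]), ← H₂.agree x fun E hE => hx E (by simp [hE])]
    simpa [errOr, eq_comm] using h0

end Realizes

theorem exists_realizes_xor (hM : M.NegExact) {u v : M.carrier} (hu : M.Generated b u)
    (hv : M.Generated b v) :
    ∃ h L, M.Realizes b L h (fun x => xor (u.1 x) (v.1 x)) ∧ L.length ≤ 3 := by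
  have H := (hu.realizes.or hv.realizes).and ((hu.realizes.and hv.realizes).neg hM)
  refine ⟨_, _, ⟨H.generated, H.errors, fun x hx => ?_⟩, by simp⟩
  rw [H.agree x hx]
  cases u.1 x <;> cases v.1 x <;> rfl

theorem exists_realizes_mux (hM : M.NegExact) {c u v : M.carrier} (hc : M.Generated b c)
    (hu : M.Generated b u) (hv : M.Generated b v) :
    ∃ h L, M.Realizes b L h (fun x => bif c.1 x then v.1 x else u.1 x) ∧ L.length ≤ 3 := by
  have H := ((hc.realizes.neg hM).and hu.realizes).or (hc.realizes.and hv.realizes)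
  refine ⟨_, _, ⟨H.generated, H.errors, fun x hx => ?_⟩, by simp⟩
  rw [H.agree x hx]
  cases c.1 x <;> simp

/-- A full adder: the bits `p` and `q` realize the sum and the carry of three bits. -/
theorem exists_fullAdder (hM : M.NegExact) {s u v : M.carrier} (hs : M.Generated b s)
    (hu : M.Generated b u) (hv : M.Generated b v) :
    ∃ p q : M.carrier, ∃ L : List (Set (Fin n → Bool)), M.Generated b p ∧ M.Generated b q ∧
      (∀ E ∈ L, E ∈ M.generatedErrors b) ∧ L.length ≤ 9 ∧ ∀ x, (∀ E ∈ L, x ∉ E) →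
        (s.1 x).toNat + (u.1 x).toNat + (v.1 x).toNat = (p.1 x).toNat + 2 * (q.1 x).toNat := by
  obtain ⟨w, Lw, hw, hLw⟩ := exists_realizes_xor hM hu hv
  obtain ⟨p, Lp, hp, hLp⟩ := exists_realizes_xor hM hs hw.generated
  obtain ⟨q, Lq, hq, hLq⟩ : ∃ q Lq, M.Realizes b Lq q
      (fun x => u.1 x && v.1 x || s.1 x && w.1 x) ∧ Lq.length ≤ 3 :=
    ⟨_, _, (hu.realizes.and hv.realizes).or (hs.realizes.and hw.generated.realizes), by simp⟩
  refine ⟨p, q, Lw ++ Lp ++ Lq, hp.generated, hq.generated, ?_, ?_, fun x hx => ?_⟩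
  · simp only [List.forall_mem_append]
    exact ⟨⟨hw.errors, hp.errors⟩, hq.errors⟩
  · simp only [List.length_append]
    omega
  · simp only [List.forall_mem_append] at hx
    rw [hp.agree x hx.1.2, hq.agree x hx.2, hw.agree x hx.1.1]
    cases s.1 x <;> cases u.1 x <;> cases v.1 x <;> rfl

/-- The number of functions in the list that take the value `true` at `x`. -/
def count (l : List M.carrier) (x : Fin n → Bool) : ℕ := (l.map fun u => (u.1 x).toNat).sum

/-- A chain of `k` full adders turns `2 k + 1` bits of weight `1` into one bit of weight `1` and
`k` bits of weight `2`. -/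
theorem exists_carries (hM : M.NegExact) (k : ℕ) : ∀ (s : M.carrier) (l : List M.carrier),
    l.length = 2 * k → M.Generated b s → (∀ u ∈ l, M.Generated b u) →
    ∃ (l' : List M.carrier) (L : List (Set (Fin n → Bool))), l'.length = k ∧
      (∀ u ∈ l', M.Generated b u) ∧ (∀ E ∈ L, E ∈ M.generatedErrors b) ∧ L.length ≤ 9 * k ∧
      ∀ x, (∀ E ∈ L, x ∉ E) → ∃ e ≤ 1, (s.1 x).toNat + count l x = e + 2 * count l' x := by
  induction k with
  | zero =>
    intro s l hl _ _
    obtain rfl := List.length_eq_zero_iff.1 hl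
    exact ⟨[], [], rfl, by simp, by simp, by simp, fun x _ =>
      ⟨(s.1 x).toNat, Bool.toNat_le _, by simp [count]⟩⟩
  | succ k ih =>
    intro s l hl hs hgen
    match l, hl with
    | u :: v :: l, hl =>
      obtain ⟨p, q, L₁, hp, hq, hL₁, hlen₁, h₁⟩ :=
        exists_fullAdder hM hs (hgen u (by simp)) (hgen v (by simp))
      obtain ⟨l', L₂, hl', hgen', hL₂, hlen₂, h₂⟩ :=
        ih p l (by simp at hl; omega) hp fun w hw => hgen w (by simp [hw])
      refine ⟨q :: l', L₁ ++ L₂, by simp [hl'], ?_, ?_, ?_, fun x hx => ?_⟩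
      · exact List.forall_mem_cons.2 ⟨hq, hgen'⟩
      · exact List.forall_mem_append.2 ⟨hL₁, hL₂⟩
      · rw [List.length_append]
        omega
      · obtain ⟨hx₁, hx₂⟩ := List.forall_mem_append.1 hx
        obtain ⟨e, he, h⟩ := h₂ x hx₂
        refine ⟨e, he, ?_⟩
        have := h₁ x hx₁
        simp only [count, List.map_cons, List.sum_cons] at h ⊢
        omega

/-- The majority of `2 ^ (d + 1) - 1` bits is the leading binary digit of their sum. Hence it is
the majority of the carries of a chain of full adders, and a linear number of gates suffices. -/
theorem exists_majority (hM : M.NegExact) (d : ℕ) : ∀ l : List M.carrier,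
    l.length + 1 = 2 ^ (d + 1) → (∀ u ∈ l, M.Generated b u) →
    ∃ (h : M.carrier) (L : List (Set (Fin n → Bool))), M.Generated b h ∧
      (∀ E ∈ L, E ∈ M.generatedErrors b) ∧ L.length ≤ 9 * l.length ∧
      ∀ x, (∀ E ∈ L, x ∉ E) → (h.1 x = true ↔ 2 ^ d ≤ count l x) := by
  induction d with
  | zero =>
    intro l hl hgen
    obtain ⟨u, rfl⟩ := List.length_eq_one_iff.1 (show l.length = 1 by simpa using hl)
    refine ⟨u, [], hgen u (by simp), by simp, by simp, fun x _ => ?_⟩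
    cases h : u.1 x <;> simp [count, h]
  | succ d ih =>
    intro l hl hgen
    match l, hl with
    | [], hl =>
      have := Nat.one_lt_two_pow (n := d + 1 + 1) (by omega)
      simp only [List.length_nil] at hl
      omega
    | s :: l, hl =>
      rw [List.length_cons, pow_succ] at hl
      have hpos : 0 < 2 ^ (d + 1) := by positivity
      obtain ⟨l', L₁, hl', hgen', hL₁, hlen₁, h₁⟩ := exists_carries hM (2 ^ (d + 1) - 1) s l
        (by omega) (hgen s (by simp)) fun w hw => hgen w (by simp [hw])
      obtain ⟨h, L₂, hh, hL₂, hlen₂, h₂⟩ := ih l' (by omega) hgen'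
      refine ⟨h, L₁ ++ L₂, hh, List.forall_mem_append.2 ⟨hL₁, hL₂⟩, ?_, fun x hx => ?_⟩
      · rw [List.length_append, List.length_cons]
        omega
      · obtain ⟨hx₁, hx₂⟩ := List.forall_mem_append.1 hx
        obtain ⟨e, he, h⟩ := h₁ x hx₁
        rw [h₂ x hx₂]
        have hc : count (s :: l) x = e + 2 * count l' x := by simpa [count] using h
        rw [hc, pow_succ]
        omega

end LegitimateModel
end ApproxMethod

namespace ApproxMethod

/-! ### Covering and sampling -/

section Counting

open Finset
open scoped Classical

theorem card_filter_exists_mem_le {α : Type} {B : Finset α} {β : ℕ} {L : List (Set α)}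
    (h : ∀ E ∈ L, #{x ∈ B | x ∈ E} ≤ β) : #{x ∈ B | ∃ E ∈ L, x ∈ E} ≤ L.length * β := by
  induction L with
  | nil => simp
  | cons E L ih =>
    obtain ⟨h₁, h₂⟩ := List.forall_mem_cons.1 h
    have : ({x ∈ B | ∃ F ∈ E :: L, x ∈ F} : Finset α) ⊆
        {x ∈ B | x ∈ E} ∪ {x ∈ B | ∃ F ∈ L, x ∈ F} := by
      intro x
      simp only [mem_filter, mem_union, List.exists_mem_cons_iff]
      tauto
    calc _ ≤ _ := card_le_card this
      _ ≤ _ := card_union_le _ _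
      _ ≤ β + L.length * β := Nat.add_le_add h₁ (ih h₂)
      _ = _ := by rw [List.length_cons]; ring

/-- Greedy covering: if every nonempty part of `B` has a `1 / D` fraction of its points in some
member of `𝓕`, then `D log |B|` members of `𝓕` cover `B`. -/
theorem exists_cover {α : Type} (𝓕 : Set (Set α)) {D N : ℕ} (hD : 0 < D) (hN : 0 < N)
    (B : Finset α) (hB : #B ≤ 2 ^ N)
    (h : ∀ B' ⊆ B, B'.Nonempty → ∃ E ∈ 𝓕, #B' ≤ D * #{x ∈ B' | x ∈ E}) :
    ∃ L : List (Set α), L.length ≤ D * N ∧ (∀ E ∈ L, E ∈ 𝓕) ∧ ∀ x ∈ B, ∃ E ∈ L, x ∈ E := by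
  have hD' : (0 : ℝ) < D := by exact_mod_cast hD
  have h1 : (0 : ℝ) ≤ 1 - 1 / D := by
    rw [sub_nonneg, div_le_one hD']
    exact_mod_cast hD
  have step : ∀ t : ℕ, ∃ L : List (Set α), L.length ≤ t ∧ (∀ E ∈ L, E ∈ 𝓕) ∧
      (#{x ∈ B | ∀ E ∈ L, x ∉ E} : ℝ) ≤ (1 - 1 / D) ^ t * #B := by
    intro t
    induction t with
    | zero => exact ⟨[], by simp⟩
    | succ t ih =>
      obtain ⟨L, hL, hLF, hc⟩ := ih
      set B' : Finset α := {x ∈ B | ∀ E ∈ L, x ∉ E} with hB'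
      rcases B'.eq_empty_or_nonempty with he | hne
      · exact ⟨L, by omega, hLF, by
          rw [← hB', he, card_empty, Nat.cast_zero]
          exact mul_nonneg (pow_nonneg h1 _) (Nat.cast_nonneg _)⟩
      · obtain ⟨E, hE, hEc⟩ := h B' (filter_subset _ _) hne
        refine ⟨E :: L, by simpa using hL, List.forall_mem_cons.2 ⟨hE, hLF⟩, ?_⟩
        have hsplit : #{x ∈ B' | x ∈ E} + #{x ∈ B | ∀ F ∈ E :: L, x ∉ F} = #B' := by
          rw [← card_filter_add_card_filter_not (s := B') (· ∈ E)]
          congr 2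
          ext x
          simp only [hB', mem_filter, List.forall_mem_cons]
          tauto
        have hEc' : (#B' : ℝ) ≤ D * #{x ∈ B' | x ∈ E} := by exact_mod_cast hEc
        have hsplit' : (#{x ∈ B' | x ∈ E} : ℝ) + #{x ∈ B | ∀ F ∈ E :: L, x ∉ F} = #B' := by
          exact_mod_cast hsplit
        have hdiv : (#B' : ℝ) / D ≤ #{x ∈ B' | x ∈ E} := by
          rw [div_le_iff₀ hD']
          linarith
        calc (#{x ∈ B | ∀ F ∈ E :: L, x ∉ F} : ℝ) ≤ (1 - 1 / D) * #B' := by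
              have : (1 - 1 / (D : ℝ)) * #B' = #B' - #B' / D := by ring
              linarith
          _ ≤ (1 - 1 / D) * ((1 - 1 / D) ^ t * #B) := mul_le_mul_of_nonneg_left hc h1
          _ = _ := by ring
  obtain ⟨L, hL, hLF, hc⟩ := step (D * N)
  refine ⟨L, hL, hLF, ?_⟩
  by_contra! hx
  obtain ⟨x, hxB, hx⟩ := hx
  have hpos : (1 : ℝ) ≤ #{x ∈ B | ∀ E ∈ L, x ∉ E} := by
    exact_mod_cast card_pos.2 ⟨x, mem_filter.2 ⟨hxB, hx⟩⟩
  have hexp : (1 - 1 / (D : ℝ)) ^ D ≤ Real.exp (-1) := by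
    calc (1 - 1 / (D : ℝ)) ^ D ≤ Real.exp (-(1 / D)) ^ D := by
          gcongr
          have := Real.add_one_le_exp (-(1 / (D : ℝ)))
          linarith
      _ = Real.exp (-1) := by
          rw [← Real.exp_nat_mul]
          congr 1
          field_simp
  have h2 : Real.exp (-1) * 2 < 1 := by
    rw [Real.exp_neg, inv_mul_lt_iff₀ (Real.exp_pos 1)]
    linarith [Real.exp_one_gt_d9]
  have : (1 - 1 / (D : ℝ)) ^ (D * N) * #B < 1 := by
    calc (1 - 1 / (D : ℝ)) ^ (D * N) * #B ≤ Real.exp (-1) ^ N * 2 ^ N := by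
          rw [pow_mul]
          gcongr
          exact_mod_cast hB
      _ = (Real.exp (-1) * 2) ^ N := by rw [mul_pow]
      _ < 1 := pow_lt_one₀ (by positivity) h2 hN.ne'
  linarith

/-- If each point of `R` is misjudged by at most a `1 / 16` fraction of the elements of `A`, then
some `T > log |R|` elements are such that each point is misjudged by a minority of them. -/
theorem exists_sample {α A : Type} [Fintype A] [Nonempty A] (W : A → α → Prop) (R : Finset α)
    (hW : ∀ x ∈ R, 16 * #{a | W a x} ≤ Fintype.card A) {N T : ℕ} (hR : #R ≤ 2 ^ N) (hT : N < T) :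
    ∃ l : List A, l.length = T ∧ ∀ x ∈ R, 2 * l.countP (fun a => W a x) < T := by
  -- The elements are chosen one by one. An average choice at most doubles the potential below.
  have step : ∀ t : ℕ, ∃ l : List A, l.length = t ∧
      ∑ x ∈ R, 16 ^ l.countP (fun a => W a x) ≤ #R * 2 ^ t := by
    intro t
    induction t with
    | zero => exact ⟨[], by simp⟩
    | succ t ih =>
      obtain ⟨l, hl, hs⟩ := ih
      have avg : ∑ a : A, ∑ x ∈ R, 16 ^ (a :: l).countP (fun a => W a x) ≤
          ∑ _a : A, #R * 2 ^ (t + 1) := by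
        rw [sum_comm, sum_const, card_univ, smul_eq_mul]
        calc ∑ x ∈ R, ∑ a : A, 16 ^ (a :: l).countP (fun a => W a x)
            ≤ ∑ x ∈ R, 16 ^ l.countP (fun a => W a x) * (2 * Fintype.card A) := by
              refine sum_le_sum fun x hx => ?_
              have : ∀ a : A, 16 ^ (a :: l).countP (fun a => W a x) =
                  16 ^ l.countP (fun a => W a x) * (1 + 15 * if W a x then 1 else 0) := by
                intro a
                by_cases ha : W a x <;> simp [ha, pow_succ]
              rw [sum_congr rfl fun a _ => this a, ← mul_sum, sum_add_distrib, ← mul_sum,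
                ← card_filter]
              have := hW x hx
              simp only [sum_const, card_univ, smul_eq_mul, mul_one]
              gcongr
              omega
          _ ≤ #R * 2 ^ t * (2 * Fintype.card A) := by
              rw [← sum_mul]
              gcongr
          _ = _ := by ring
      obtain ⟨a, -, ha⟩ := exists_le_of_sum_le univ_nonempty avg
      exact ⟨a :: l, by simp [hl], ha⟩
  obtain ⟨l, hl, hs⟩ := step T
  refine ⟨l, hl, fun x hx => ?_⟩
  have h1 : 16 ^ l.countP (fun a => W a x) ≤ #R * 2 ^ T :=
    (single_le_sum (f := fun x => 16 ^ l.countP (fun a => W a x)) (fun _ _ => Nat.zero_le _)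
      hx).trans hs
  have h2 : 2 ^ (4 * l.countP (fun a => W a x)) ≤ 2 ^ (N + T) := by
    rw [pow_mul, pow_add]
    exact h1.trans (Nat.mul_le_mul_right _ hR)
  have := (Nat.pow_le_pow_iff_right (by norm_num)).1 h2
  omega

/-- A Boolean function of `m + 1` variables is the pair of its restrictions to the two values of
the first variable. -/
def splitEquiv (m : ℕ) : BoolFn (m + 1) ≃ BoolFn m × BoolFn m where
  toFun a := (fun y => a (Fin.cons false y), fun y => a (Fin.cons true y))
  invFun p y := bif y 0 then p.2 (Fin.tail y) else p.1 (Fin.tail y)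
  left_inv a := by
    ext y
    cases h : y 0
    · simpa [h] using congrArg a (by rw [← h, Fin.cons_self_tail])
    · simpa [h] using congrArg a (by rw [← h, Fin.cons_self_tail])
  right_inv p := by ext <;> simp

theorem card_boolFn_succ (m : ℕ) :
    Fintype.card (BoolFn (m + 1)) = Fintype.card (BoolFn m) * Fintype.card (BoolFn m) := by
  rw [Fintype.card_congr (splitEquiv m), Fintype.card_prod]

/-- A restriction of a uniformly random function is uniformly random. -/
theorem card_filter_restrict {m : ℕ} (e : Bool) (P : BoolFn m → Prop) [DecidablePred P] :
    #{a : BoolFn (m + 1) | P fun y => a (Fin.cons e y)} = #{a | P a} * Fintype.card (BoolFn m) := by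
  cases e
  · rw [card_equiv (t := ({a | P a} : Finset (BoolFn m)) ×ˢ univ) (splitEquiv m)
      (by simp [splitEquiv]), card_product, card_univ]
  · rw [card_equiv (t := univ ×ˢ ({a | P a} : Finset (BoolFn m))) (splitEquiv m)
      (by simp [splitEquiv]), card_product, card_univ, mul_comm]

end Counting

namespace LegitimateModel

variable {n : ℕ} {M : LegitimateModel n} {ι : Type} {b : ι → M.carrier}

/-! ### Functions of generated elements -/

section

open Finset
open scoped Classical

/-- Each Boolean function `a` of `g₁, …, g_m` is approximated by an element `H a` of the model, by
branching on the variables one after another. An error at a point comes from one of the `m`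
branchings on the path of the point. For random `a`, the restriction of `a` reached by any path is
uniformly random, so the same `3 m` random error sets bound the error probabilities at all
points. -/
theorem exists_family (hM : M.NegExact) (m : ℕ) : ∀ g : Fin m → M.carrier,
    (∀ i, M.Generated b (g i)) → ∃ H : BoolFn m → M.carrier, (∀ a, M.Generated b (H a)) ∧
      ∀ (B : Finset (Fin n → Bool)) (β : ℕ),
        (∀ E ∈ M.generatedErrors b, #{x ∈ B | x ∈ E} ≤ β) →
        ∑ x ∈ B, #{a | (H a).1 x ≠ a fun i => (g i).1 x} ≤
          3 * m * β * Fintype.card (BoolFn m) := by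
  induction m with
  | zero =>
    refine fun g _ => ⟨fun a => ⟨fun _ => a Fin.elim0, M.const_mem _⟩, fun a => .const _,
      fun B β _ => ?_⟩
    have : ∀ (a : BoolFn 0) (y : Fin 0 → Bool), a Fin.elim0 = a y := fun a y =>
      congrArg a (Subsingleton.elim _ _)
    simpa using fun x _ a => this a fun i => (g i).1 x
  | succ m ih =>
    intro g hg
    obtain ⟨H, hH, hB⟩ := ih (fun i => g i.succ) fun i => hg _
    choose H' L hreal hlen using fun a : BoolFn (m + 1) =>
      exists_realizes_mux hM (hg 0) (hH fun y => a (Fin.cons false y))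
        (hH fun y => a (Fin.cons true y))
    refine ⟨H', fun a => (hreal a).generated, fun B β hβ => ?_⟩
    have key : ∀ x, #{a | (H' a).1 x ≠ a fun i => (g i).1 x} ≤ #{a | ∃ E ∈ L a, x ∈ E} +
        #{a | (H a).1 x ≠ a fun i => (g i.succ).1 x} * Fintype.card (BoolFn m) := by
      intro x
      rw [← card_filter_restrict ((g 0).1 x) fun a => (H a).1 x ≠ a fun i => (g i.succ).1 x]
      refine (card_le_card fun a ha => ?_).trans (card_union_le _ _)
      simp only [mem_union, mem_filter, mem_univ, true_and] at ha ⊢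
      by_contra! hcon
      refine ha ?_
      have hcons : (fun i => (g i).1 x) = Fin.cons ((g 0).1 x) fun i => (g i.succ).1 x :=
        (Fin.cons_self_tail fun i => (g i).1 x).symm
      rw [(hreal a).agree x hcon.1, hcons, ← hcon.2]
      cases (g 0).1 x <;> rfl
    have hfst : ∑ x ∈ B, #{a | ∃ E ∈ L a, x ∈ E} ≤ 3 * β * Fintype.card (BoolFn (m + 1)) := by
      calc ∑ x ∈ B, #{a | ∃ E ∈ L a, x ∈ E}
          = ∑ a : BoolFn (m + 1), #{x ∈ B | ∃ E ∈ L a, x ∈ E} :=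
            sum_card_bipartiteAbove_eq_sum_card_bipartiteBelow _
        _ ≤ ∑ _a : BoolFn (m + 1), 3 * β := sum_le_sum fun a _ =>
            (card_filter_exists_mem_le fun E hE => hβ E ((hreal a).errors E hE)).trans
              (Nat.mul_le_mul_right _ (hlen a))
        _ = _ := by rw [sum_const, card_univ, smul_eq_mul, mul_comm]
    calc ∑ x ∈ B, #{a | (H' a).1 x ≠ a fun i => (g i).1 x}
        ≤ ∑ x ∈ B, (#{a | ∃ E ∈ L a, x ∈ E} +
          #{a | (H a).1 x ≠ a fun i => (g i.succ).1 x} * Fintype.card (BoolFn m)) :=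
          sum_le_sum fun x _ => key x
      _ ≤ 3 * β * Fintype.card (BoolFn (m + 1)) +
          3 * m * β * Fintype.card (BoolFn m) * Fintype.card (BoolFn m) := by
          rw [sum_add_distrib, ← sum_mul]
          exact Nat.add_le_add hfst (Nat.mul_le_mul_right _ (hB B β hβ))
      _ = _ := by rw [card_boolFn_succ]; ring

theorem le_count_map {A : Type} (X : A → M.carrier) (W : A → Prop) (x : Fin n → Bool) (l : List A)
    (h : ∀ a ∈ l, ¬ W a → (X a).1 x = true) :
    l.length ≤ count (l.map X) x + l.countP (fun a => W a) := by
  induction l with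
  | nil => simp
  | cons a l ih =>
    obtain ⟨h₁, h₂⟩ := List.forall_mem_cons.1 h
    have := ih h₂
    simp only [count, List.map_cons, List.sum_cons, List.length_cons, List.countP_cons] at this ⊢
    by_cases ha : W a
    · simp only [ha, decide_true, if_true]
      omega
    · simp only [h₁ ha, Bool.toNat_true]
      omega

theorem count_map_le {A : Type} (X : A → M.carrier) (W : A → Prop) (x : Fin n → Bool) (l : List A)
    (h : ∀ a ∈ l, ¬ W a → (X a).1 x = false) :
    count (l.map X) x ≤ l.countP (fun a => W a) := by
  induction l with
  | nil => simp [count]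
  | cons a l ih =>
    obtain ⟨h₁, h₂⟩ := List.forall_mem_cons.1 h
    have := ih h₂
    simp only [count, List.map_cons, List.sum_cons, List.countP_cons] at this ⊢
    by_cases ha : W a
    · have := Bool.toNat_le ((X a).1 x)
      simp only [ha, decide_true, if_true]
      omega
    · simp only [h₁ ha, Bool.toNat_false]
      omega

/-- If each point `x` of `R` gets a wrong value from `H a` for at most a `1 / 32` fraction of the
`a`, then any Boolean function `φ` of `g₁, …, g_m` agrees on `R` with an element of the model outside
`O (log |R|)` error sets. Indeed `φ` is the sum of the two uniformly random functions `a` and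
`a + φ`; sums of this kind vote on the value of `φ`. -/
theorem exists_approx_of_family (hM : M.NegExact) {m N : ℕ} {g : Fin m → M.carrier}
    {H : BoolFn m → M.carrier} (hH : ∀ a, M.Generated b (H a)) (φ : BoolFn m)
    (R : Finset (Fin n → Bool)) (hR : #R ≤ 2 ^ N) (hN : 0 < N)
    (hgood : ∀ x ∈ R, 32 * #{a | (H a).1 x ≠ a fun i => (g i).1 x} ≤ Fintype.card (BoolFn m)) :
    ∃ (h : M.carrier) (L : List (Set (Fin n → Bool))), M.Generated b h ∧
      (∀ E ∈ L, E ∈ M.generatedErrors b) ∧ L.length ≤ 36 * N ∧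
      ∀ x ∈ R, (∀ E ∈ L, x ∉ E) → h.1 x = φ fun i => (g i).1 x := by
  obtain ⟨shift, hshift⟩ : ∃ e : BoolFn m ≃ BoolFn m, ∀ a y, e a y = xor (a y) (φ y) :=
    ⟨Function.Involutive.toPerm (fun a y => xor (a y) (φ y)) fun a => by ext y; simp,
      fun _ _ => rfl⟩
  obtain ⟨V, hV⟩ : ∃ V : BoolFn m → (Fin n → Bool) → Prop,
      ∀ a x, V a x ↔ (H a).1 x ≠ a fun i => (g i).1 x := ⟨_, fun _ _ => Iff.rfl⟩
  simp only [← hV] at hgood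
  obtain ⟨W, hWdef⟩ : ∃ W : BoolFn m → (Fin n → Bool) → Prop,
      ∀ a x, W a x ↔ V a x ∨ V (shift a) x := ⟨_, fun _ _ => Iff.rfl⟩
  have hW : ∀ x ∈ R, 16 * #{a | W a x} ≤ Fintype.card (BoolFn m) := by
    intro x hx
    have hcard : #{a | V (shift a) x} = #{a | V a x} := card_equiv shift (by simp)
    have hle : #{a | W a x} ≤ #{a | V a x} + #{a | V (shift a) x} := by
      simp only [hWdef, filter_or]
      exact card_union_le _ _
    have := hgood x hx
    omega
  -- The number of voters is `2 ^ (d + 1) - 1`, which lies between `N + 1` and `2 N + 1`.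
  obtain ⟨d, hd₁, hd₂⟩ : ∃ d, 2 ^ d ≤ N + 1 ∧ N + 1 < 2 ^ (d + 1) :=
    ⟨Nat.log 2 (N + 1), Nat.pow_log_le_self 2 (by omega), Nat.lt_pow_succ_log_self (by omega) _⟩
  rw [pow_succ] at hd₂
  obtain ⟨l, hl, hvote⟩ := exists_sample W R hW hR (show N < 2 ^ d * 2 - 1 by omega)
  choose X LX hX hLX using fun a => exists_realizes_xor hM (hH a) (hH (shift a))
  obtain ⟨h, L, hh, hL, hlen, hmaj⟩ := exists_majority hM d (l.map X)
    (by rw [List.length_map, pow_succ]; omega)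
    (List.forall_mem_map.2 fun a _ => (hX a).generated)
  have hlen' : (l.flatMap LX).length ≤ 3 * l.length := by
    rw [List.length_flatMap]
    refine (List.sum_le_card_nsmul _ 3 ?_).trans_eq ?_
    · simpa using fun a _ => hLX a
    · rw [List.length_map, smul_eq_mul, mul_comm]
  refine ⟨h, l.flatMap LX ++ L, hh, ?_, ?_, fun x hxR hx => ?_⟩
  · simp only [List.forall_mem_append, List.mem_flatMap]
    exact ⟨fun E ⟨a, _, hE⟩ => (hX a).errors E hE, hL⟩
  · rw [List.length_map] at hlen
    rw [List.length_append]
    omega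
  · simp only [List.forall_mem_append, List.mem_flatMap] at hx
    obtain ⟨hx₁, hx₂⟩ := hx
    have hv := hvote x hxR
    have hval : ∀ a ∈ l, ¬ W a x → (X a).1 x = φ fun i => (g i).1 x := by
      intro a ha hWa
      rw [(hX a).agree x fun E hE => hx₁ E ⟨a, ha, hE⟩]
      simp only [hWdef, hV, not_or, not_not] at hWa
      rw [hWa.1, hWa.2, hshift]
      simp
    cases hφ : φ fun i => (g i).1 x
    · have := count_map_le X (fun a => W a x) x l (by rwa [hφ] at hval)
      rw [← Bool.not_eq_true, hmaj x hx₂]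
      omega
    · have := le_count_map X (fun a => W a x) x l (by rwa [hφ] at hval)
      rw [hmaj x hx₂]
      omega

/-- On a set `R` of at most `2 ^ N` points, any Boolean function `φ` of `g₁, …, g_m` agrees with an
element of the model outside `O (N m)` error sets. -/
theorem exists_approx_on (hM : M.NegExact) {m N : ℕ} {g : Fin m → M.carrier}
    (hg : ∀ i, M.Generated b (g i)) (φ : BoolFn m) (R : Finset (Fin n → Bool)) (hR : #R ≤ 2 ^ N) :
    ∃ (h : M.carrier) (L : List (Set (Fin n → Bool))), M.Generated b h ∧
      (∀ E ∈ L, E ∈ M.generatedErrors b) ∧ L.length ≤ 132 * (N * m) ∧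
      ∀ x ∈ R, (∀ E ∈ L, x ∉ E) → h.1 x = φ fun i => (g i).1 x := by
  -- For `m = 0` or `N = 0` no error sets are available, but then `φ` is constant on `R`.
  by_cases hconst : ∃ c, ∀ x ∈ R, (φ fun i => (g i).1 x) = c
  · obtain ⟨c, hc⟩ := hconst
    exact ⟨_, [], .const c, by simp, by simp, fun x hx _ => (hc x hx).symm⟩
  have hm : 0 < m := by
    rw [Nat.pos_iff_ne_zero]
    rintro rfl
    exact hconst ⟨φ Fin.elim0, fun x _ => congrArg φ (Subsingleton.elim _ _)⟩
  have hN : 0 < N := by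
    rw [Nat.pos_iff_ne_zero]
    rintro rfl
    rcases R.eq_empty_or_nonempty with rfl | ⟨y, hy⟩
    · exact hconst ⟨true, by simp⟩
    · refine hconst ⟨φ fun i => (g i).1 y, fun x hx => ?_⟩
      rw [card_le_one.1 (by simpa using hR) x hx y hy]
  obtain ⟨H, hH, hB⟩ := exists_family hM m g hg
  have hA : 0 < Fintype.card (BoolFn m) := Fintype.card_pos
  generalize hcard : Fintype.card (BoolFn m) = A at hB hA
  -- The points at which more than a `1 / 32` fraction of the `H a` err are covered greedily.
  obtain ⟨L₁, hlen₁, hL₁, hcov⟩ := exists_cover (M.generatedErrors b) (D := 96 * m) (by omega) hN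
    {x ∈ R | A < 32 * #{a | (H a).1 x ≠ a fun i => (g i).1 x}} ((card_filter_le _ _).trans hR) (by
      intro B hBR hne
      by_contra! hcon
      -- The largest integer below `#B / (96 m)` bounds the part of `B` in an error set.
      have hβ : ∀ E ∈ M.generatedErrors b, #{x ∈ B | x ∈ E} ≤ (#B - 1) / (96 * m) := by
        intro E hE
        rw [Nat.le_div_iff_mul_le (by omega), mul_comm]
        exact Nat.le_sub_one_of_lt (hcon E hE)
      have h₁ := hB B _ hβ
      have h₂ : #B * A ≤ 32 * ∑ x ∈ B, #{a | (H a).1 x ≠ a fun i => (g i).1 x} := by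
        rw [← smul_eq_mul, ← sum_const, mul_sum]
        exact sum_le_sum fun x hx => (mem_filter.1 (hBR hx)).2.le
      have h₃ : 32 * (3 * m * ((#B - 1) / (96 * m)) * A) ≤ (#B - 1) * A := by
        calc _ = (96 * m) * ((#B - 1) / (96 * m)) * A := by ring
          _ ≤ _ := Nat.mul_le_mul_right _ (Nat.mul_div_le _ _)
      have h₄ := Nat.le_of_mul_le_mul_right ((h₂.trans (Nat.mul_le_mul_left _ h₁)).trans h₃) hA
      have := hne.card_pos
      omega)
  obtain ⟨h, L₂, hh, hL₂, hlen₂, hagree⟩ := exists_approx_of_family hM (g := g) hH φ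
    {x ∈ R | ∀ E ∈ L₁, x ∉ E} ((card_filter_le _ _).trans hR) hN (by
      intro x hx
      obtain ⟨hxR, hx⟩ := mem_filter.1 hx
      by_contra! hlt
      obtain ⟨E, hE, hxE⟩ := hcov x (mem_filter.2 ⟨hxR, hcard ▸ hlt⟩)
      exact hx E hE hxE)
  refine ⟨h, L₁ ++ L₂, hh, List.forall_mem_append.2 ⟨hL₁, hL₂⟩, ?_, fun x hxR hx => ?_⟩
  · rw [List.length_append]
    have h₁ : N ≤ N * m := Nat.le_mul_of_pos_right _ hm
    have h₂ : 96 * m * N = 96 * (N * m) := by ring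
    omega
  · obtain ⟨hx₁, hx₂⟩ := List.forall_mem_append.1 hx
    exact hagree x (mem_filter.2 ⟨hxR, hx₁⟩) hx₂

/-- If the elements generated by `b` depend only on the class `π x` of `x`, with at most `2 ^ N`
classes, then so do the error sets, and it suffices to look at one point of each class. -/
theorem exists_approx (hM : M.NegExact) {m N : ℕ} {g : Fin m → M.carrier}
    (hg : ∀ i, M.Generated b (g i)) (π : (Fin n → Bool) → Fin N → Bool)
    (hπ : ∀ u, M.Generated b u → ∀ x y, π x = π y → u.1 x = u.1 y) (φ : BoolFn m) :
    ∃ (h : M.carrier) (L : List (Set (Fin n → Bool))), (∀ E ∈ L, E ∈ M.errorSets) ∧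
      L.length ≤ 132 * (N * m) ∧ ∀ x, (∀ E ∈ L, x ∉ E) → h.1 x = φ fun i => (g i).1 x := by
  let r (c : Fin N → Bool) : Fin n → Bool := Function.invFun π c
  have hr : ∀ x, π (r (π x)) = π x := fun x => Function.invFun_eq ⟨x, rfl⟩
  obtain ⟨h, L, hh, hL, hlen, hagree⟩ := exists_approx_on hM hg φ (univ.image r)
    (card_image_le.trans (by simp) : _ ≤ 2 ^ N)
  refine ⟨h, L, fun E hE => generatedErrors_subset (hL E hE), hlen, fun x hx => ?_⟩
  have hgx : (fun i => (g i).1 x) = fun i => (g i).1 (r (π x)) :=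
    funext fun i => hπ _ (hg i) _ _ (hr x).symm
  rw [hgx, hπ h hh _ _ (hr x).symm]
  refine hagree _ (mem_image_of_mem _ (mem_univ _)) fun E hE hmem => hx E hE ?_
  obtain ⟨u, v, hu, hv, rfl | rfl⟩ := hL E hE
  · simpa [errAnd, hπ u hu _ _ (hr x), hπ v hv _ _ (hr x), hπ _ (hu.and hv) _ _ (hr x)] using hmem
  · simpa [errOr, hπ u hu _ _ (hr x), hπ v hv _ _ (hr x), hπ _ (hu.or hv) _ _ (hr x)] using hmem

end

end LegitimateModel
end ApproxMethod

namespace ApproxMethod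

/-! ### Generated elements and circuits -/

/-- The same vertex after one more gate has been listed. -/
def Node.lift {ι : Type} {s : ℕ} : Node ι s → Node ι (s + 1)
  | .input i => .input i
  | .gate j => .gate j.castSucc

theorem Node.eval_lift {ι A α : Type} {m s : ℕ} (I : Interp α A m) (inp : ι → α)
    (G : Gates ι A m s) (g : Gate ι A m s) (v : Node ι s) :
    v.lift.eval inp ((G.snoc g).eval I inp) = v.eval inp (G.eval I inp) := by
  cases v with
  | input i => rfl
  | gate j => exact Fin.snoc_castSucc (α := fun _ => α) ..

theorem Node.eval_gate_last {ι A α : Type} {m s : ℕ} (I : Interp α A m) (inp : ι → α)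
    (G : Gates ι A m s) (g : Gate ι A m s) :
    (Node.gate (Fin.last s)).eval inp ((G.snoc g).eval I inp) = g.eval I inp (G.eval I inp) :=
  Fin.snoc_last (α := fun _ => α) ..

namespace LegitimateModel

variable {n : ℕ} {M : LegitimateModel n} {ι : Type} {b : ι → M.carrier}

/-- Any list of gates can be extended so as to compute a given generated element, the values of the
old vertices being kept. -/
theorem Generated.exists_gates {u : M.carrier} (hu : M.Generated b u) :
    ∀ {s : ℕ} (G : Gates ι Empty 0 s), ∃ (s' : ℕ) (G' : Gates ι Empty 0 s')
      (e : Node ι s → Node ι s') (w : Node ι s'),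
      (∀ v, (e v).eval b (G'.eval M.interp b) = v.eval b (G.eval M.interp b)) ∧
      w.eval b (G'.eval M.interp b) = u := by
  induction hu with
  | const c =>
    exact fun G => ⟨_, G.snoc (.const c), Node.lift, .gate (Fin.last _),
      Node.eval_lift _ _ _ _, Node.eval_gate_last ..⟩
  | base i => exact fun G => ⟨_, G, id, .input i, fun _ => rfl, rfl⟩
  | neg _ ih =>
    intro s G
    obtain ⟨s₁, G₁, e₁, w₁, he₁, hw₁⟩ := ih G
    refine ⟨_, G₁.snoc (.neg w₁), fun v => (e₁ v).lift, .gate (Fin.last _), fun v => ?_, ?_⟩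
    · rw [Node.eval_lift, he₁]
    · rw [Node.eval_gate_last, ← hw₁]
      rfl
  | and _ _ ih₁ ih₂ =>
    intro s G
    obtain ⟨s₁, G₁, e₁, w₁, he₁, hw₁⟩ := ih₁ G
    obtain ⟨s₂, G₂, e₂, w₂, he₂, hw₂⟩ := ih₂ G₁
    refine ⟨_, G₂.snoc (.and (e₂ w₁) w₂), fun v => (e₂ (e₁ v)).lift, .gate (Fin.last _),
      fun v => ?_, ?_⟩
    · rw [Node.eval_lift, he₂, he₁]
    · rw [Node.eval_gate_last, ← hw₁, ← hw₂, ← he₂]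
      rfl
  | or _ _ ih₁ ih₂ =>
    intro s G
    obtain ⟨s₁, G₁, e₁, w₁, he₁, hw₁⟩ := ih₁ G
    obtain ⟨s₂, G₂, e₂, w₂, he₂, hw₂⟩ := ih₂ G₁
    refine ⟨_, G₂.snoc (.or (e₂ w₁) w₂), fun v => (e₂ (e₁ v)).lift, .gate (Fin.last _),
      fun v => ?_, ?_⟩
    · rw [Node.eval_lift, he₂, he₁]
    · rw [Node.eval_gate_last, ← hw₁, ← hw₂, ← he₂]
      rfl

theorem Generated.exists_circuit {u : M.carrier} (hu : M.Generated b u) :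
    ∃ C : PlainCircuit ι, M.approx C b = u.1 := by
  obtain ⟨s, G, -, w, -, hw⟩ := hu.exists_gates .nil
  exact ⟨⟨s, G, w⟩, congrArg Subtype.val hw⟩

/-! ### Circuits with oracle gates -/

variable (M) in
/-- `u` is an input function or its approximate negation. -/
def IsLiteral (u : M.carrier) : Prop := ∃ i, u = M.var i ∨ u = M.neg (M.var i)

variable (M) in
/-- Any Boolean function of `g₁, …, g_m` agrees with an element of the model outside `c` error
sets. -/
def OracleCost {m : ℕ} (c : ℕ) (g : Fin m → M.carrier) : Prop :=
  ∀ φ : BoolFn m, ∃ (h : M.carrier) (L : List (Set (Fin n → Bool))), (∀ E ∈ L, E ∈ M.errorSets) ∧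
    L.length ≤ c ∧ ∀ x, (∀ E ∈ L, x ∉ E) → h.1 x = φ fun i => (g i).1 x

/-- The elements `h` approximate the gates of `G` outside the error sets listed in `L`, and those
at negated inputs are literals of the model. -/
structure ApproxGates {m s : ℕ} (G : Gates (Fin n) (BoolFn m) m s) (h : Fin s → M.carrier)
    (L : List (Set (Fin n → Bool))) : Prop where
  errors : ∀ E ∈ L, E ∈ M.errorSets
  agree : ∀ x, (∀ E ∈ L, x ∉ E) → ∀ j, (h j).1 x = G.eval (boolInterp m) x j
  literal : ∀ j, G.IsNegInput j → M.IsLiteral (h j)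

namespace ApproxGates

variable {m s : ℕ} {G : Gates (Fin n) (BoolFn m) m s} {h : Fin s → M.carrier}
  {L : List (Set (Fin n → Bool))}

theorem agree_node (H : ApproxGates G h L) {x : Fin n → Bool} (hx : ∀ E ∈ L, x ∉ E)
    (v : Node (Fin n) s) : (v.eval M.var h).1 x = v.eval x (G.eval (boolInterp m) x) := by
  cases v with
  | input i => rfl
  | gate j => exact H.agree x hx j

theorem isLiteral_node (H : ApproxGates G h L) {v : Node (Fin n) s} (hv : G.IsLiteral v) :
    M.IsLiteral (v.eval M.var h) := by
  cases v with
  | input i => exact ⟨i, Or.inl rfl⟩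
  | gate j => exact H.literal j hv

theorem snoc (H : ApproxGates G h L) (g : Gate (Fin n) (BoolFn m) m s) (u : M.carrier)
    (L' : List (Set (Fin n → Bool))) (hL' : ∀ E ∈ L', E ∈ M.errorSets)
    (hu : ∀ x, (∀ E ∈ L, x ∉ E) → (∀ E ∈ L', x ∉ E) →
      u.1 x = g.eval (boolInterp m) x (G.eval (boolInterp m) x))
    (hlit : ∀ i, g = .neg (.input i) → M.IsLiteral u) :
    ApproxGates (G.snoc g) (Fin.snoc (α := fun _ => M.carrier) h u) (L' ++ L) where
  errors := List.forall_mem_append.2 ⟨hL', H.errors⟩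
  agree x hx j := by
    obtain ⟨hx', hx⟩ := List.forall_mem_append.1 hx
    refine Fin.lastCases ?_ (fun j => ?_) j
    · simpa [Gates.eval] using hu x hx hx'
    · simpa [Gates.eval] using H.agree x hx j
  literal j := by
    refine Fin.lastCases ?_ (fun j => ?_) j
    · simpa [Gates.IsNegInput] using hlit
    · simpa [Gates.IsNegInput] using H.literal j

end ApproxGates

/-- Gate by gate, each ordinary gate costs at most one error set and each oracle gate at most `c`
of them. -/
theorem exists_approxGates (hM : M.NegExact) {m c : ℕ} {s : ℕ}
    (G : Gates (Fin n) (BoolFn m) m s)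
    (hG : (∀ g : Fin m → M.carrier, M.OracleCost c g) ∨ G.OraclesReadLiterals ∧
      ∀ g : Fin m → M.carrier, (∀ i, M.IsLiteral (g i)) → M.OracleCost c g) :
    ∃ h L, ApproxGates (M := M) G h L ∧ L.length ≤ s + c * G.numOracles := by
  induction G with
  | nil => exact ⟨Fin.elim0, [], ⟨by simp, fun _ _ j => j.elim0, fun j => j.elim0⟩, by simp⟩
  | @snoc s G g ih =>
    obtain ⟨h, L, H, hlen⟩ := ih (hG.imp_right fun hG => ⟨hG.1.1, hG.2⟩)
    cases g with
    | const e =>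
      refine ⟨_, _, H.snoc _ ⟨fun _ => e, M.const_mem e⟩ [] (by simp) (fun _ _ _ => rfl)
        (by simp), ?_⟩
      simp only [List.nil_append, Gates.numOracles]
      omega
    | neg v =>
      refine ⟨_, _, H.snoc _ (M.neg (v.eval M.var h)) [] (by simp) (fun x hx _ => ?_) ?_, ?_⟩
      · rw [hM, H.agree_node hx]
        rfl
      · intro i hi
        obtain rfl : v = .input i := by simpa using hi
        exact ⟨i, Or.inr rfl⟩
      · simp only [List.nil_append, Gates.numOracles]
        omega
    | and v w =>
      refine ⟨_, _, H.snoc _ (M.and (v.eval M.var h) (w.eval M.var h))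
        [M.errAnd (v.eval M.var h) (w.eval M.var h)] ?_ (fun x hx hx' => ?_) (by simp), ?_⟩
      · exact List.forall_mem_singleton.2 (Or.inr (Or.inl ⟨_, _, rfl⟩))
      · have := hx' _ (List.mem_singleton_self _)
        simp only [errAnd, Set.mem_ofPred_eq, not_not, H.agree_node hx] at this
        rw [← this]
        rfl
      · simp only [List.length_append, List.length_singleton, Gates.numOracles]
        omega
    | or v w =>
      refine ⟨_, _, H.snoc _ (M.or (v.eval M.var h) (w.eval M.var h))
        [M.errOr (v.eval M.var h) (w.eval M.var h)] ?_ (fun x hx hx' => ?_) (by simp), ?_⟩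
      · exact List.forall_mem_singleton.2 (Or.inr (Or.inr ⟨_, _, rfl⟩))
      · have := hx' _ (List.mem_singleton_self _)
        simp only [errOr, Set.mem_ofPred_eq, not_not, H.agree_node hx] at this
        rw [← this]
        rfl
      · simp only [List.length_append, List.length_singleton, Gates.numOracles]
        omega
    | oracle φ a =>
      have hcost : M.OracleCost c fun i => (a i).eval M.var h := by
        rcases hG with hG | hG
        · exact hG _
        · exact hG.2 _ fun i => H.isLiteral_node (hG.1.2 φ a rfl i)
      obtain ⟨u, L', hL', hlen', hu⟩ := hcost φ
      refine ⟨_, _, H.snoc _ u L' hL' (fun x hx hx' => ?_) (by simp), ?_⟩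
      · rw [hu x hx']
        exact congrArg φ (funext fun i => H.agree_node hx (a i))
      · simp only [List.length_append, Gates.numOracles, mul_add]
        omega

/-- A circuit computing `f` bounds the distance of `f` from the model. -/
theorem not_computes (hM : M.NegExact) {m c k s : ℕ} {f : BoolFn n} (hs : (s : ℕ∞) ≤ M.dist f)
    (C : OracleCircuit n m) (hk : C.numOracles ≤ k) (hsize : C.size + c * k < s)
    (hC : (∀ g : Fin m → M.carrier, M.OracleCost c g) ∨ C.OraclesReadLiterals ∧
      ∀ g : Fin m → M.carrier, (∀ i, M.IsLiteral (g i)) → M.OracleCost c g) :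
    ¬ C.Computes f := by
  intro hf
  obtain ⟨h, L, H, hlen⟩ := exists_approxGates hM C.gates hC
  have hcov : M.Covered f L.length := by
    refine ⟨(C.output.eval M.var h).1, (C.output.eval M.var h).2, L.get,
      fun i => H.errors _ (List.get_mem L i), fun x hx => ?_⟩
    by_contra hcon
    refine hx ?_
    rw [H.agree_node, ← hf x]
    · rfl
    · intro E hE hxE
      obtain ⟨i, rfl⟩ := List.get_of_mem hE
      exact hcon (Set.mem_iUnion.2 ⟨i, hxE⟩)
  have h1 : (s : ℕ∞) ≤ L.length := hs.trans (iInf₂_le _ hcov)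
  have h2 : s ≤ L.length := by exact_mod_cast h1
  have h3 : c * C.gates.numOracles ≤ c * k := Nat.mul_le_mul_left _ hk
  omega

theorem oracleCost (hM : M.NegExact) {m : ℕ} (g : Fin m → M.carrier) :
    M.OracleCost (132 * (n * m)) g :=
  fun φ => exists_approx hM (b := g) .base id (fun _ _ _ _ h => congrArg _ h) φ

theorem ZeroProjective.oracleCost (hM : M.NegExact) (hP : M.ZeroProjective) {m : ℕ}
    (g : Fin m → M.carrier) (hg : ∀ i, M.IsLiteral (g i)) : M.OracleCost (132 * (m * m)) g := by
  intro φ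
  choose j hj using hg
  refine exists_approx hM (b := fun i : Set.range j => M.var i.1) (fun i => ?_)
    (fun x i => x (j i)) (fun u hu x y hxy => ?_) φ
  · have hb := Generated.base (b := fun i : Set.range j => M.var i.1) ⟨j i, i, rfl⟩
    rcases hj i with h | h
    · exact h ▸ hb
    · exact h ▸ hb.neg
  · obtain ⟨C, hC⟩ := hu.exists_circuit
    rw [← hC]
    refine hP _ C x y ?_
    rintro _ ⟨i, rfl⟩
    exact congrFun hxy i

theorem Projective.oracleCost (hM : M.NegExact) (hP : M.Projective) {m : ℕ}
    (g : Fin m → M.carrier) : M.OracleCost (132 * (m * m)) g := by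
  refine exists_approx hM (b := g) .base (fun x i => (g i).1 x) fun u hu x y hxy => ?_
  obtain ⟨C, hC⟩ := hu.exists_circuit
  rw [← hC]
  exact hP _ C g x y fun i => congrFun hxy i

end LegitimateModel

end ApproxMethod

theorem theorem3 :
    ∃ K : ℕ, ∀ (n k m s : ℕ) (M : ApproxMethod.LegitimateModel n), M.NegExact →
      ∀ f : ApproxMethod.BoolFn n, (s : ℕ∞) ≤ M.dist f →
        (∀ C : ApproxMethod.OracleCircuit n m, C.numOracles ≤ k →
          C.size + K * (k * n * m) < s → ¬ C.Computes f) ∧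
        (M.ZeroProjective →
          ∀ C : ApproxMethod.OracleCircuit n m, C.numOracles ≤ k → C.OraclesReadLiterals →
            C.size + K * (k * m ^ 2) < s → ¬ C.Computes f) ∧
        (M.Projective →
          ∀ C : ApproxMethod.OracleCircuit n m, C.numOracles ≤ k →
            C.size + K * (k * m ^ 2) < s → ¬ C.Computes f) := by
  refine ⟨132, fun n k m s M hM f hs => ⟨fun C hk hsize => ?_, fun hP C hk hlit hsize => ?_,
    fun hP C hk hsize => ?_⟩⟩
  · exact M.not_computes hM hs C hk (by convert hsize using 2; ring) (Or.inl (M.oracleCost hM))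
  · exact M.not_computes hM hs C hk (by convert hsize using 2; ring)
      (Or.inr ⟨hlit, hP.oracleCost hM⟩)
  · exact M.not_computes hM hs C hk (by convert hsize using 2; ring)
      (Or.inl (hP.oracleCost hM))
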